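/- Let $d\ge 1$ and let $\varrho_0$ be a probability density function on $\mathbb{R}^d$ with finite second moments, mean $\mu_0\in\mathbb{R}^d$ and covariance matrix $P_0\succ 0$, and let $\tau_0:=\operatorname{tr}(P_0)$. Fix $\mu\in\mathbb{R}^d$ and $\tau>0$, and let $\mathscr{D}_{\mu,\tau}$ be the set of probability density functions on $\mathbb{R}^d$ with finite second moments whose mean is $\mu$ and whose covariance matrix has trace $\tau$. For densities $\varrho_1,\varrho_2$ let $$W_2(\varrho_1,\varrho_2)=\Big(\inf_{\sigma}\int_{\mathbb{R}^d\times\mathbb{R}^d}\|x-y\|_2^2\,\mathrm{d}\sigma(x,y)\Big)^{1/2},$$ where the infimum is over all probability measures $\sigma$ on $\mathbb{R}^d\times\mathbb{R}^d$ with finite second moments and with marginals $\varrho_1(x)\,\mathrm{d}x$ and $\varrho_2(y)\,\mathrm{d}y$. Then $$\inf_{\varrho\in\mathscr{D}_{\mu,\tau}} W_2^2(\varrho,\varrho_0)=\big(\sqrt{\tau}-\sqrt{\tau_0}\big)^2+\|\mu-\mu_0\|_2^2,$$ and the infimum is attained at the density $$\varrho(x)=\Big(\frac{\tau_0}{\tau}\Big)^{d/2}\varrho_0\Big(\sqrt{\tfrac{\tau_0}{\tau}}\,(x-\mu)+\mu_0\Big),$$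 which belongs to $\mathscr{D}_{\mu,\tau}$. -/

import Mathlib

open MeasureTheory
open scoped ENNReal

noncomputable section

namespace DensityTransport

/-- Probability density functions on `ℝ^d` (with respect to Lebesgue measure). -/
def Densities (d : ℕ) : Set (EuclideanSpace ℝ (Fin d) → ℝ) :=
  {ρ | (∀ x, 0 ≤ ρ x) ∧ Integrable ρ ∧ ∫ x, ρ x = 1}

/-- Probability density functions on `ℝ^d` with finite second moments. -/
def Densities₂ (d : ℕ) : Set (EuclideanSpace ℝ (Fin d) → ℝ) :=
  {ρ | ρ ∈ Densities d ∧ Integrable (fun x => ‖x‖ ^ 2 * ρ x)}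

/-- The mean vector of a density. -/
def mean {d : ℕ} (ρ : EuclideanSpace ℝ (Fin d) → ℝ) : EuclideanSpace ℝ (Fin d) :=
  ∫ x, ρ x • x

/-- The covariance matrix of a density. -/
def covarianceMatrix {d : ℕ} (ρ : EuclideanSpace ℝ (Fin d) → ℝ) : Matrix (Fin d) (Fin d) ℝ :=
  Matrix.of fun i j => ∫ x, (x i - mean ρ i) * (x j - mean ρ j) * ρ x

/-- The densities with finite second moments, mean `μ`, and covariance of trace `τ`. -/
def DensitiesMeanTrace {d : ℕ} (μ : EuclideanSpace ℝ (Fin d)) (τ : ℝ) :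
    Set (EuclideanSpace ℝ (Fin d) → ℝ) :=
  {ρ | ρ ∈ Densities₂ d ∧ mean ρ = μ ∧ (covarianceMatrix ρ).trace = τ}

/-- The measure `ρ(x) dx`. -/
def toMeasure {d : ℕ} (ρ : EuclideanSpace ℝ (Fin d) → ℝ) : Measure (EuclideanSpace ℝ (Fin d)) :=
  volume.withDensity fun x => ENNReal.ofReal (ρ x)

/-- The couplings of two measures on `ℝ^d`: probability measures on the product with finite
second moments and the given marginals. -/
def Couplings {d : ℕ} (m₁ m₂ : Measure (EuclideanSpace ℝ (Fin d))) :
    Set (Measure (EuclideanSpace ℝ (Fin d) × EuclideanSpace ℝ (Fin d))) :=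
  {σ | IsProbabilityMeasure σ ∧ MemLp Prod.fst 2 σ ∧ MemLp Prod.snd 2 σ ∧
    σ.map Prod.fst = m₁ ∧ σ.map Prod.snd = m₂}

/-- The Wasserstein-2 distance of two densities, with values in `[0, ∞]` (it is `∞` if and only
if there is no coupling with finite second moments). -/
def W₂ {d : ℕ} (ρ₁ ρ₂ : EuclideanSpace ℝ (Fin d) → ℝ) : ℝ≥0∞ :=
  (⨅ σ ∈ Couplings (toMeasure ρ₁) (toMeasure ρ₂), ∫⁻ z, ‖z.1 - z.2‖ₑ ^ 2 ∂σ) ^ (1 / 2 : ℝ)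

end DensityTransport

end

/-! This is Kantorovich duality with explicit quadratic potentials. For t > 0, a function of x and a
function of y, each a multiple of the squared distance to the mean plus a linear term, add up, with
‖μ - ν‖², to at most ‖x - y‖². Against any coupling their integral depends only on the two means and
traces; t = √(τ₂/τ₁) makes it (√τ₁ - √τ₂)² + ‖μ - ν‖², which gives the lower bound (`le_W₂_sq`).
Equality holds on the graph y - ν = t(x - μ), so the coupling carried by this homothety is optimal
(`W₂_homothety_sq_le`). The claimed minimizer is the density of the corresponding image of ρ₀
(`toMeasure_homothety`). -/

namespace DensityTransport

/-! ### Quadratic potentials and couplings of measures -/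

section Measures

theorem memLp_sub_const_id {F : Type*} [NormedAddCommGroup F] [MeasurableSpace F] {m : Measure F}
    [IsProbabilityMeasure m] (hm : MemLp id 2 m) (μ : F) : MemLp (fun x => x - μ) 2 m :=
  hm.sub (memLp_const μ)

theorem integrable_norm_sub_sq {F : Type*} [NormedAddCommGroup F] [MeasurableSpace F]
    {m : Measure F} [IsProbabilityMeasure m] (hm : MemLp id 2 m) (μ : F) :
    Integrable (fun x => ‖x - μ‖ ^ 2) m :=
  (memLp_two_iff_integrable_sq_norm (memLp_sub_const_id hm μ).1).1 (memLp_sub_const_id hm μ)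

variable {E : Type*} [NormedAddCommGroup E] [InnerProductSpace ℝ E]

/-- The `x`-part of the pair of Kantorovich potentials that is optimal between a measure with
mean `μ` and its image under a homothety of ratio `t` that sends `μ` to `μ - c`. -/
def fstPotential (t : ℝ) (μ c x : E) : ℝ :=
  (1 - t) * ‖x - μ‖ ^ 2 + 2 * inner ℝ c (x - μ)

/-- The gap between the two sides is exactly t⁻¹ ‖t(x - μ) - (y - ν)‖². -/
theorem fstPotential_add_fstPotential_le {t : ℝ} (ht : 0 < t) (μ ν x y : E) :
    fstPotential t μ (μ - ν) x + fstPotential t⁻¹ ν (ν - μ) y + ‖μ - ν‖ ^ 2 ≤ ‖x - y‖ ^ 2 := by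
  have h1 : x - y = (x - μ) - (y - ν) + (μ - ν) := by abel
  have h2 : ν - μ = -(μ - ν) := by abel
  unfold fstPotential
  rw [h1, h2]
  generalize x - μ = a
  generalize y - ν = b
  generalize μ - ν = c
  have h3 : 0 ≤ t⁻¹ * ‖t • a - b‖ ^ 2 := by positivity
  rw [norm_sub_sq_real, norm_smul, inner_smul_left, mul_pow, Real.norm_eq_abs, sq_abs] at h3
  rw [norm_add_sq_real, norm_sub_sq_real, inner_sub_left, inner_neg_left,
    real_inner_comm c a, real_inner_comm c b]
  have h4 : t⁻¹ * (t ^ 2 * ‖a‖ ^ 2 - 2 * (t * inner ℝ a b) + ‖b‖ ^ 2)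
      = t * ‖a‖ ^ 2 - 2 * inner ℝ a b + t⁻¹ * ‖b‖ ^ 2 := by
    field_simp
  simp only [conj_trivial] at h3
  rw [h4] at h3
  linarith

theorem norm_homothety_sub_sq {t : ℝ} (ht : 0 < t) (μ ν y : E) :
    ‖(t⁻¹ • (y - ν) + μ) - y‖ ^ 2 = fstPotential t μ (μ - ν) (t⁻¹ • (y - ν) + μ)
      + fstPotential t⁻¹ ν (ν - μ) y + ‖μ - ν‖ ^ 2 := by
  have h1 : (t⁻¹ • (y - ν) + μ) - y = (t⁻¹ - 1) • (y - ν) + (μ - ν) := by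
    rw [sub_smul, one_smul]; abel
  have h2 : ν - μ = -(μ - ν) := by abel
  unfold fstPotential
  rw [h1, h2, add_sub_cancel_right]
  generalize y - ν = b
  generalize μ - ν = c
  rw [norm_add_sq_real, norm_smul, norm_smul, mul_pow, mul_pow, Real.norm_eq_abs,
    Real.norm_eq_abs, sq_abs, sq_abs, inner_smul_left, inner_smul_right, inner_neg_left,
    real_inner_comm c b]
  simp only [conj_trivial]
  field_simp
  ring

variable [MeasurableSpace E]

theorem integrable_inner_sub {m : Measure E} [IsProbabilityMeasure m] (hm : MemLp id 2 m)
    (μ c : E) : Integrable (fun x => inner ℝ c (x - μ)) m :=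
  ((memLp_sub_const_id hm μ).integrable one_le_two).const_inner c

theorem integrable_fstPotential {m : Measure E} [IsProbabilityMeasure m] (hm : MemLp id 2 m)
    (t : ℝ) (μ c : E) : Integrable (fstPotential t μ c) m :=
  ((integrable_norm_sub_sq hm μ).const_mul _).add ((integrable_inner_sub hm μ c).const_mul _)

/-- The linear term integrates to zero because μ is the mean. -/
theorem integral_fstPotential [CompleteSpace E] {m : Measure E} [IsProbabilityMeasure m]
    (hm : MemLp id 2 m) (t : ℝ) {μ : E} (c : E) (hμ : ∫ x, x ∂m = μ) :
    ∫ x, fstPotential t μ c x ∂m = (1 - t) * ∫ x, ‖x - μ‖ ^ 2 ∂m := by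
  have hx : Integrable (fun x : E => x) m := hm.integrable one_le_two
  have h0 : ∫ x, inner ℝ c (x - μ) ∂m = 0 := by
    rw [integral_inner ((memLp_sub_const_id hm μ).integrable one_le_two),
      integral_sub hx (integrable_const μ), hμ]
    simp
  unfold fstPotential
  rw [integral_add ((integrable_norm_sub_sq hm μ).const_mul _)
    ((integrable_inner_sub hm μ c).const_mul _), integral_const_mul, integral_const_mul, h0]
  simp

theorem integrable_potentials {σ : Measure (E × E)} [IsProbabilityMeasure σ]
    {m₁ m₂ : Measure E} (h₁ : σ.map Prod.fst = m₁) (h₂ : σ.map Prod.snd = m₂)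
    (hm₁ : MemLp id 2 m₁) (hm₂ : MemLp id 2 m₂) (t : ℝ) (μ ν : E) :
    Integrable (fun z : E × E => fstPotential t μ (μ - ν) z.1
      + fstPotential t⁻¹ ν (ν - μ) z.2 + ‖μ - ν‖ ^ 2) σ := by
  subst h₁ h₂
  have := Measure.isProbabilityMeasure_map (μ := σ) measurable_fst.aemeasurable
  have := Measure.isProbabilityMeasure_map (μ := σ) measurable_snd.aemeasurable
  exact (((integrable_fstPotential hm₁ t μ _).comp_measurable measurable_fst).add
    ((integrable_fstPotential hm₂ t⁻¹ ν _).comp_measurable measurable_snd)).add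
    (integrable_const _)

/-- The integral is (1 - t)τ₁ + (1 - t⁻¹)τ₂ + ‖μ - ν‖², and t = √(τ₂/τ₁) is the ratio that maximizes
it. -/
theorem integral_potentials [CompleteSpace E] {σ : Measure (E × E)} [IsProbabilityMeasure σ]
    {m₁ m₂ : Measure E} (h₁ : σ.map Prod.fst = m₁) (h₂ : σ.map Prod.snd = m₂)
    (hm₁ : MemLp id 2 m₁) (hm₂ : MemLp id 2 m₂) {μ ν : E} (hμ : ∫ x, x ∂m₁ = μ)
    (hν : ∫ x, x ∂m₂ = ν) {τ₁ τ₂ : ℝ} (hτ₁ : ∫ x, ‖x - μ‖ ^ 2 ∂m₁ = τ₁)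
    (hτ₂ : ∫ x, ‖x - ν‖ ^ 2 ∂m₂ = τ₂) (pos₁ : 0 < τ₁) (pos₂ : 0 < τ₂) :
    ∫ z, (fstPotential √(τ₂ / τ₁) μ (μ - ν) z.1
      + fstPotential (√(τ₂ / τ₁))⁻¹ ν (ν - μ) z.2 + ‖μ - ν‖ ^ 2) ∂σ
      = (√τ₁ - √τ₂) ^ 2 + ‖μ - ν‖ ^ 2 := by
  subst h₁ h₂
  have := Measure.isProbabilityMeasure_map (μ := σ) measurable_fst.aemeasurable
  have := Measure.isProbabilityMeasure_map (μ := σ) measurable_snd.aemeasurable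
  have i₁ := integrable_fstPotential hm₁ √(τ₂ / τ₁) μ (μ - ν)
  have i₂ := integrable_fstPotential hm₂ (√(τ₂ / τ₁))⁻¹ ν (ν - μ)
  have e₁ := integral_map measurable_fst.aemeasurable i₁.1
  have e₂ := integral_map measurable_snd.aemeasurable i₂.1
  have j₁ : Integrable (fun z : E × E => fstPotential √(τ₂ / τ₁) μ (μ - ν) z.1) σ :=
    i₁.comp_measurable measurable_fst
  have j₂ : Integrable (fun z : E × E => fstPotential (√(τ₂ / τ₁))⁻¹ ν (ν - μ) z.2) σ :=
    i₂.comp_measurable measurable_snd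
  have j₃ : Integrable (fun z : E × E => fstPotential √(τ₂ / τ₁) μ (μ - ν) z.1
      + fstPotential (√(τ₂ / τ₁))⁻¹ ν (ν - μ) z.2) σ := j₁.add j₂
  rw [integral_add j₃ (integrable_const _), integral_add j₁ j₂, ← e₁, ← e₂,
    integral_fstPotential hm₁ _ _ hμ, integral_fstPotential hm₂ _ _ hν, hτ₁, hτ₂,
    Real.sqrt_div pos₂.le]
  have s₁ := Real.sqrt_pos.2 pos₁
  have s₂ := Real.sqrt_pos.2 pos₂
  have q₁ := Real.sq_sqrt pos₁.le
  have q₂ := Real.sq_sqrt pos₂.le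
  generalize √τ₁ = a at s₁ q₁ ⊢
  generalize √τ₂ = b at s₂ q₂ ⊢
  simp only [integral_const, probReal_univ, smul_eq_mul, ← q₁, ← q₂]
  field_simp
  ring

theorem lintegral_enorm_sub_sq_ge [CompleteSpace E] {σ : Measure (E × E)}
    [IsProbabilityMeasure σ]
    {m₁ m₂ : Measure E} (h₁ : σ.map Prod.fst = m₁) (h₂ : σ.map Prod.snd = m₂)
    (hm₁ : MemLp id 2 m₁) (hm₂ : MemLp id 2 m₂) {μ ν : E} (hμ : ∫ x, x ∂m₁ = μ)
    (hν : ∫ x, x ∂m₂ = ν) {τ₁ τ₂ : ℝ} (hτ₁ : ∫ x, ‖x - μ‖ ^ 2 ∂m₁ = τ₁)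
    (hτ₂ : ∫ x, ‖x - ν‖ ^ 2 ∂m₂ = τ₂) (pos₁ : 0 < τ₁) (pos₂ : 0 < τ₂) :
    ENNReal.ofReal ((√τ₁ - √τ₂) ^ 2 + ‖μ - ν‖ ^ 2) ≤ ∫⁻ z, ‖z.1 - z.2‖ₑ ^ 2 ∂σ := by
  have hsub : MemLp (fun z : E × E => z.1 - z.2) 2 σ := by
    subst h₁ h₂
    exact (hm₁.comp_of_map measurable_fst.aemeasurable).sub
      (hm₂.comp_of_map measurable_snd.aemeasurable)
  have hint := (memLp_two_iff_integrable_sq_norm hsub.1).1 hsub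
  have e : ∫⁻ z, ‖z.1 - z.2‖ₑ ^ 2 ∂σ = ENNReal.ofReal (∫ z, ‖z.1 - z.2‖ ^ 2 ∂σ) := by
    rw [ofReal_integral_eq_lintegral_ofReal hint (.of_forall fun _ => by positivity)]
    simp [ENNReal.ofReal_pow]
  rw [e, ← integral_potentials h₁ h₂ hm₁ hm₂ hμ hν hτ₁ hτ₂ pos₁ pos₂]
  refine ENNReal.ofReal_le_ofReal (integral_mono (integrable_potentials h₁ h₂ hm₁ hm₂ _ _ _)
    hint fun z => ?_)
  exact fstPotential_add_fstPotential_le (by positivity) _ _ _ _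

-- The image measure lives on the graph of the homothety, where cost and potentials agree pointwise.
variable [BorelSpace E] [SecondCountableTopology E] in
theorem lintegral_homothety_enorm_sub_sq [CompleteSpace E] {m₁ m₂ : Measure E}
    [IsProbabilityMeasure m₂] {μ ν : E} {τ₁ τ₂ : ℝ}
    (hmap : m₂.map (fun y => (√(τ₂ / τ₁))⁻¹ • (y - ν) + μ) = m₁)
    (hm₁ : MemLp id 2 m₁) (hm₂ : MemLp id 2 m₂) (hμ : ∫ x, x ∂m₁ = μ)
    (hν : ∫ x, x ∂m₂ = ν) (hτ₁ : ∫ x, ‖x - μ‖ ^ 2 ∂m₁ = τ₁)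
    (hτ₂ : ∫ x, ‖x - ν‖ ^ 2 ∂m₂ = τ₂) (pos₁ : 0 < τ₁) (pos₂ : 0 < τ₂) :
    ∫⁻ z, ‖z.1 - z.2‖ₑ ^ 2 ∂(m₂.map fun y => ((√(τ₂ / τ₁))⁻¹ • (y - ν) + μ, y))
      = ENNReal.ofReal ((√τ₁ - √τ₂) ^ 2 + ‖μ - ν‖ ^ 2) := by
  have hT : Measurable fun y : E => ((√(τ₂ / τ₁))⁻¹ • (y - ν) + μ, y) := by fun_prop
  have hσ := Measure.isProbabilityMeasure_map (μ := m₂) hT.aemeasurable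
  have h₁ : (m₂.map fun y => ((√(τ₂ / τ₁))⁻¹ • (y - ν) + μ, y)).map Prod.fst = m₁ := by
    rw [Measure.map_map measurable_fst hT]; exact hmap
  have h₂ : (m₂.map fun y => ((√(τ₂ / τ₁))⁻¹ • (y - ν) + μ, y)).map Prod.snd = m₂ := by
    rw [Measure.map_map measurable_snd hT]; exact Measure.map_id
  have hi := integrable_potentials h₁ h₂ hm₁ hm₂ √(τ₂ / τ₁) μ ν
  rw [← integral_potentials h₁ h₂ hm₁ hm₂ hμ hν hτ₁ hτ₂ pos₁ pos₂,
    integral_map hT.aemeasurable hi.1, lintegral_map (by fun_prop) hT]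
  refine Eq.trans ?_ (ofReal_integral_eq_lintegral_ofReal (hi.comp_measurable hT) ?_).symm
  · refine lintegral_congr fun y => ?_
    simp only [Function.comp_apply]
    rw [← norm_homothety_sub_sq (by positivity), ENNReal.ofReal_pow (norm_nonneg _),
      ofReal_norm]
  -- The potentials may be negative in general; on the graph their sum is a squared norm.
  · refine .of_forall fun y => ?_
    simp only [Pi.zero_apply, Function.comp_apply]
    rw [← norm_homothety_sub_sq (by positivity)]
    positivity

end Measures

/-! ### Densities as measures, and their images under homotheties -/

section Densities

variable {d : ℕ} {ρ : EuclideanSpace ℝ (Fin d) → ℝ}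

theorem integral_toMeasure {F : Type*} [NormedAddCommGroup F] [NormedSpace ℝ F]
    (h0 : ∀ x, 0 ≤ ρ x) (hρ : AEMeasurable ρ) (g : EuclideanSpace ℝ (Fin d) → F) :
    ∫ x, g x ∂toMeasure ρ = ∫ x, ρ x • g x := by
  unfold toMeasure
  rw [integral_withDensity_eq_integral_toReal_smul₀ hρ.ennreal_ofReal
    (.of_forall fun _ => ENNReal.ofReal_lt_top)]
  simp only [ENNReal.toReal_ofReal (h0 _)]

theorem integrable_toMeasure_iff {F : Type*} [NormedAddCommGroup F] [NormedSpace ℝ F]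
    (h0 : ∀ x, 0 ≤ ρ x) (hρ : AEMeasurable ρ) (g : EuclideanSpace ℝ (Fin d) → F) :
    Integrable g (toMeasure ρ) ↔ Integrable fun x => ρ x • g x := by
  unfold toMeasure
  rw [integrable_withDensity_iff_integrable_smul₀' hρ.ennreal_ofReal
    (.of_forall fun _ => ENNReal.ofReal_lt_top)]
  simp only [ENNReal.toReal_ofReal (h0 _)]

theorem mem_Densities_iff :
    ρ ∈ Densities d ↔
      (∀ x, 0 ≤ ρ x) ∧ AEMeasurable ρ ∧ IsProbabilityMeasure (toMeasure ρ) := by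
  have key : ∀ h0 : ∀ x, 0 ≤ ρ x, toMeasure ρ Set.univ = ∫⁻ x, ENNReal.ofReal (ρ x) := by
    intro h0
    simp [toMeasure]
  constructor
  · rintro ⟨h0, hi, h1⟩
    refine ⟨h0, hi.1.aemeasurable, ⟨?_⟩⟩
    rw [key h0, ← ofReal_integral_eq_lintegral_ofReal hi (.of_forall h0), h1, ENNReal.ofReal_one]
  · rintro ⟨h0, hm, hp⟩
    have hi : Integrable ρ := by
      simpa using (integrable_toMeasure_iff h0 hm fun _ => (1 : ℝ)).1 (integrable_const _)
    refine ⟨h0, hi, ?_⟩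
    simpa using (integral_toMeasure h0 hm fun _ => (1 : ℝ)).symm

theorem mem_Densities₂_iff :
    ρ ∈ Densities₂ d ↔ (∀ x, 0 ≤ ρ x) ∧ AEMeasurable ρ ∧ IsProbabilityMeasure (toMeasure ρ) ∧
      MemLp id 2 (toMeasure ρ) := by
  have key : ∀ h0 : ∀ x, 0 ≤ ρ x, AEMeasurable ρ →
      (Integrable (fun x => ‖x‖ ^ 2 * ρ x) ↔ MemLp id 2 (toMeasure ρ)) := by
    intro h0 hm
    rw [memLp_two_iff_integrable_sq_norm aestronglyMeasurable_id,
      integrable_toMeasure_iff h0 hm]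
    simp [mul_comm]
  change _ ∧ _ ↔ _
  rw [mem_Densities_iff]
  constructor
  · rintro ⟨⟨h0, hm, hp⟩, h⟩
    exact ⟨h0, hm, hp, (key h0 hm).1 h⟩
  · rintro ⟨h0, hm, hp, h⟩
    exact ⟨⟨h0, hm, hp⟩, (key h0 hm).2 h⟩

theorem mean_eq_integral_toMeasure (h0 : ∀ x, 0 ≤ ρ x) (hρ : AEMeasurable ρ) :
    mean ρ = ∫ x, x ∂toMeasure ρ :=
  (integral_toMeasure h0 hρ _).symm

theorem trace_covarianceMatrix (hρ : ρ ∈ Densities₂ d) :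
    (covarianceMatrix ρ).trace = ∫ x, ‖x - mean ρ‖ ^ 2 ∂toMeasure ρ := by
  obtain ⟨h0, hm, hp, h2⟩ := mem_Densities₂_iff.1 hρ
  simp only [EuclideanSpace.norm_sq_eq]
  rw [integral_finsetSum]
  · refine Finset.sum_congr rfl fun i _ => ?_
    rw [integral_toMeasure h0 hm]
    simp only [Matrix.diag_apply, covarianceMatrix, Matrix.of_apply, smul_eq_mul,
      PiLp.sub_apply, Real.norm_eq_abs, sq_abs]
    exact integral_congr_ae (.of_forall fun x => by ring)
  · intro i _
    refine (integrable_norm_sub_sq h2 (mean ρ)).mono' (by fun_prop) (.of_forall fun x => ?_)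
    rw [Real.norm_of_nonneg (by positivity)]
    gcongr
    exact PiLp.norm_apply_le _ i

theorem mem_DensitiesMeanTrace_iff {μ : EuclideanSpace ℝ (Fin d)} {τ : ℝ} :
    ρ ∈ DensitiesMeanTrace μ τ ↔
      ρ ∈ Densities₂ d ∧ ∫ x, x ∂toMeasure ρ = μ ∧ ∫ x, ‖x - μ‖ ^ 2 ∂toMeasure ρ = τ := by
  refine and_congr_right fun hρ => ?_
  obtain ⟨h0, hm, -, -⟩ := mem_Densities₂_iff.1 hρ
  rw [trace_covarianceMatrix hρ, mean_eq_integral_toMeasure h0 hm]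
  exact and_congr_right fun h => by rw [h]

/-- Translations and dilations are measurable isomorphisms, so `h` need not be measurable; this
matters since densities are only a.e. measurable. -/
theorem lintegral_comp_homothety {κ : ℝ} (hκ : 0 < κ) (μ ν : EuclideanSpace ℝ (Fin d))
    (h : EuclideanSpace ℝ (Fin d) → ℝ≥0∞) :
    ENNReal.ofReal (κ ^ d) * ∫⁻ x, h (κ • (x - μ) + ν) = ∫⁻ x, h x := by
  have e1 : ∫⁻ x, h (κ • (x - μ) + ν) = ∫⁻ x, h (κ • x + ν) :=
    lintegral_sub_right_eq_self (fun x => h (κ • x + ν)) μ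
  have e2 : ∫⁻ x, h (κ • x + ν) = ∫⁻ x, h (x + ν) ∂(volume.map (κ • ·)) :=
    ((Homeomorph.smulOfNeZero κ hκ.ne').measurableEmbedding.lintegral_map
      fun x => h (x + ν)).symm
  have hd : 0 < κ ^ d := by positivity
  rw [e1, e2, Measure.map_addHaar_smul _ hκ.ne', lintegral_smul_measure,
    lintegral_add_right_eq_self h, finrank_euclideanSpace_fin, abs_of_pos (by positivity),
    smul_eq_mul, ← mul_assoc, ← ENNReal.ofReal_mul hd.le, mul_inv_cancel₀ hd.ne',
    ENNReal.ofReal_one, one_mul]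

theorem aemeasurable_comp_homothety {κ : ℝ} (hκ : 0 < κ) (μ ν : EuclideanSpace ℝ (Fin d))
    (hρ : AEMeasurable ρ) : AEMeasurable fun x => ρ (κ • (x - μ) + ν) := by
  have hq : Measure.QuasiMeasurePreserving
      (fun x : EuclideanSpace ℝ (Fin d) => κ • (x - μ) + ν) volume volume := by
    have hmeas : Measurable fun x : EuclideanSpace ℝ (Fin d) => κ • (x - μ) + ν := by fun_prop
    refine ⟨hmeas, Measure.AbsolutelyContinuous.mk fun s hs h0 => ?_⟩
    -- Applied to an indicator, the scaling formula shows that preimages of null sets are null.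
    have h := lintegral_comp_homothety hκ μ ν (s.indicator 1)
    rw [lintegral_indicator_one hs, h0, mul_eq_zero] at h
    rw [Measure.map_apply hmeas hs, ← lintegral_indicator_one (hmeas hs)]
    exact h.resolve_left (by simp; positivity)
  exact hρ.comp_quasiMeasurePreserving hq

theorem toMeasure_homothety {κ : ℝ} (hκ : 0 < κ) (μ ν : EuclideanSpace ℝ (Fin d)) :
    toMeasure (fun x => κ ^ d * ρ (κ • (x - μ) + ν))
      = (toMeasure ρ).map fun y => κ⁻¹ • (y - ν) + μ := by
  have hT : Measurable fun y : EuclideanSpace ℝ (Fin d) => κ⁻¹ • (y - ν) + μ := by fun_prop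
  ext s hs
  rw [Measure.map_apply hT hs, toMeasure, toMeasure, withDensity_apply _ hs,
    withDensity_apply _ (hT hs), ← lintegral_indicator hs, ← lintegral_indicator (hT hs),
    ← lintegral_comp_homothety hκ μ ν (((fun y => κ⁻¹ • (y - ν) + μ) ⁻¹' s).indicator _),
    ← lintegral_const_mul' _ _ ENNReal.ofReal_ne_top]
  refine lintegral_congr fun x => ?_
  have hx : κ⁻¹ • (κ • (x - μ) + ν - ν) + μ = x := by
    rw [add_sub_cancel_right, inv_smul_smul₀ hκ.ne', sub_add_cancel]
  by_cases h : x ∈ s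
  · rw [Set.indicator_of_mem h, Set.indicator_of_mem (by simpa only [Set.mem_preimage, hx]),
      ENNReal.ofReal_mul (by positivity)]
  · rw [Set.indicator_of_notMem h,
      Set.indicator_of_notMem (by simpa only [Set.mem_preimage, hx]), mul_zero]

theorem homothety_mem_DensitiesMeanTrace {κ τ : ℝ} (hκ : 0 < κ)
    (μ : EuclideanSpace ℝ (Fin d)) {ν : EuclideanSpace ℝ (Fin d)}
    (hρ : ρ ∈ DensitiesMeanTrace ν (κ ^ 2 * τ)) :
    (fun x => κ ^ d * ρ (κ • (x - μ) + ν)) ∈ DensitiesMeanTrace μ τ := by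
  obtain ⟨hρ₂, hmean, htrace⟩ := mem_DensitiesMeanTrace_iff.1 hρ
  obtain ⟨h0, hm, hp, h2⟩ := mem_Densities₂_iff.1 hρ₂
  have hT : Measurable fun y : EuclideanSpace ℝ (Fin d) => κ⁻¹ • (y - ν) + μ := by fun_prop
  have hx : Integrable (fun x => x - ν) (toMeasure ρ) :=
    (memLp_sub_const_id h2 ν).integrable one_le_two
  rw [mem_DensitiesMeanTrace_iff, mem_Densities₂_iff, toMeasure_homothety hκ]
  refine ⟨⟨fun x => mul_nonneg (by positivity) (h0 _),
    (aemeasurable_comp_homothety hκ μ ν hm).const_mul _,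
    Measure.isProbabilityMeasure_map hT.aemeasurable, ?_⟩, ?_, ?_⟩
  · rw [memLp_map_measure_iff aestronglyMeasurable_id hT.aemeasurable]
    exact ((memLp_sub_const_id h2 ν).const_smul κ⁻¹).add (memLp_const μ)
  · have hs : Integrable (fun x => κ⁻¹ • (x - ν)) (toMeasure ρ) := hx.smul κ⁻¹
    have hid : Integrable (fun x => x) (toMeasure ρ) := h2.integrable one_le_two
    rw [integral_map hT.aemeasurable (by fun_prop), integral_add hs (integrable_const _),
      integral_smul, integral_sub hid (integrable_const _), hmean]
    simp
  · rw [integral_map hT.aemeasurable (by fun_prop)]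
    simp only [add_sub_cancel_right, norm_smul, mul_pow, norm_inv, Real.norm_eq_abs, sq_abs,
      inv_pow]
    rw [integral_const_mul, htrace]
    field_simp

/-! ### Lower and upper bounds for the Wasserstein distance -/

theorem W₂_sq (ρ₁ ρ₂ : EuclideanSpace ℝ (Fin d) → ℝ) :
    W₂ ρ₁ ρ₂ ^ 2
      = ⨅ σ ∈ Couplings (toMeasure ρ₁) (toMeasure ρ₂), ∫⁻ z, ‖z.1 - z.2‖ₑ ^ 2 ∂σ := by
  rw [W₂, ← ENNReal.rpow_natCast, ← ENNReal.rpow_mul]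
  norm_num

theorem le_W₂_sq {ρ₁ ρ₂ : EuclideanSpace ℝ (Fin d) → ℝ} {μ ν : EuclideanSpace ℝ (Fin d)}
    {τ₁ τ₂ : ℝ} (h₁ : ρ₁ ∈ DensitiesMeanTrace μ τ₁) (h₂ : ρ₂ ∈ DensitiesMeanTrace ν τ₂)
    (pos₁ : 0 < τ₁) (pos₂ : 0 < τ₂) :
    ENNReal.ofReal ((√τ₁ - √τ₂) ^ 2 + ‖μ - ν‖ ^ 2) ≤ W₂ ρ₁ ρ₂ ^ 2 := by
  obtain ⟨hρ₁, hμ, hτ₁⟩ := mem_DensitiesMeanTrace_iff.1 h₁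
  obtain ⟨hρ₂, hν, hτ₂⟩ := mem_DensitiesMeanTrace_iff.1 h₂
  rw [W₂_sq]
  refine le_iInf₂ fun σ ⟨hσ, _, _, hfst, hsnd⟩ => ?_
  exact lintegral_enorm_sub_sq_ge hfst hsnd (mem_Densities₂_iff.1 hρ₁).2.2.2
    (mem_Densities₂_iff.1 hρ₂).2.2.2 hμ hν hτ₁ hτ₂ pos₁ pos₂

theorem W₂_homothety_sq_le {μ ν : EuclideanSpace ℝ (Fin d)} {τ₁ τ₂ : ℝ}
    {ρ₁ ρ₂ : EuclideanSpace ℝ (Fin d) → ℝ}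
    (hmap : (toMeasure ρ₂).map (fun y => (√(τ₂ / τ₁))⁻¹ • (y - ν) + μ) = toMeasure ρ₁)
    (h₁ : ρ₁ ∈ DensitiesMeanTrace μ τ₁) (h₂ : ρ₂ ∈ DensitiesMeanTrace ν τ₂)
    (pos₁ : 0 < τ₁) (pos₂ : 0 < τ₂) :
    W₂ ρ₁ ρ₂ ^ 2 ≤ ENNReal.ofReal ((√τ₁ - √τ₂) ^ 2 + ‖μ - ν‖ ^ 2) := by
  obtain ⟨hρ₁, hμ, hτ₁⟩ := mem_DensitiesMeanTrace_iff.1 h₁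
  obtain ⟨hρ₂, hν, hτ₂⟩ := mem_DensitiesMeanTrace_iff.1 h₂
  obtain ⟨-, -, hp₁, m₁⟩ := mem_Densities₂_iff.1 hρ₁
  obtain ⟨-, -, hp₂, m₂⟩ := mem_Densities₂_iff.1 hρ₂
  have hT : Measurable fun y : EuclideanSpace ℝ (Fin d) =>
    ((√(τ₂ / τ₁))⁻¹ • (y - ν) + μ, y) := by fun_prop
  rw [W₂_sq, ← lintegral_homothety_enorm_sub_sq hmap m₁ m₂ hμ hν hτ₁ hτ₂ pos₁ pos₂]
  have hfst : ((toMeasure ρ₂).map fun y => ((√(τ₂ / τ₁))⁻¹ • (y - ν) + μ, y)).map Prod.fst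
      = toMeasure ρ₁ := by
    rw [Measure.map_map measurable_fst hT]; exact hmap
  have hsnd : ((toMeasure ρ₂).map fun y => ((√(τ₂ / τ₁))⁻¹ • (y - ν) + μ, y)).map Prod.snd
      = toMeasure ρ₂ := by
    rw [Measure.map_map measurable_snd hT]; exact Measure.map_id
  refine iInf₂_le _ ⟨Measure.isProbabilityMeasure_map hT.aemeasurable, ?_, ?_, hfst, hsnd⟩
  · rw [← hfst] at m₁
    exact m₁.comp_of_map measurable_fst.aemeasurable
  · rw [← hsnd] at m₂
    exact m₂.comp_of_map measurable_snd.aemeasurable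

end Densities

end DensityTransport

theorem corollary1 (d : ℕ) (hd : 0 < d)
    (ρ₀ : EuclideanSpace ℝ (Fin d) → ℝ) (hρ₀ : ρ₀ ∈ DensityTransport.Densities₂ d)
    (μ₀ : EuclideanSpace ℝ (Fin d)) (hμ₀ : DensityTransport.mean ρ₀ = μ₀)
    (P₀ : Matrix (Fin d) (Fin d) ℝ) (hP₀ : DensityTransport.covarianceMatrix ρ₀ = P₀)
    (hP₀pos : P₀.PosDef) (τ₀ : ℝ) (hτ₀ : P₀.trace = τ₀)
    (μ : EuclideanSpace ℝ (Fin d)) (τ : ℝ) (hτ : 0 < τ) :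
    (⨅ ρ ∈ DensityTransport.DensitiesMeanTrace μ τ, DensityTransport.W₂ ρ ρ₀ ^ 2)
        = ENNReal.ofReal ((√τ - √τ₀) ^ 2 + ‖μ - μ₀‖ ^ 2) ∧
      (fun x => (τ₀ / τ) ^ ((d : ℝ) / 2) * ρ₀ (√(τ₀ / τ) • (x - μ) + μ₀))
          ∈ DensityTransport.DensitiesMeanTrace μ τ ∧
      DensityTransport.W₂
          (fun x => (τ₀ / τ) ^ ((d : ℝ) / 2) * ρ₀ (√(τ₀ / τ) • (x - μ) + μ₀)) ρ₀ ^ 2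
        = ENNReal.ofReal ((√τ - √τ₀) ^ 2 + ‖μ - μ₀‖ ^ 2) := by
  have : Nonempty (Fin d) := ⟨⟨0, hd⟩⟩
  -- Positive definiteness enters only here, as positivity of the trace, which needs d ≥ 1.
  have pos₀ : 0 < τ₀ := hτ₀ ▸ hP₀pos.trace_pos
  have hκ : 0 < √(τ₀ / τ) := by positivity
  have hscale : (τ₀ / τ) ^ ((d : ℝ) / 2) = √(τ₀ / τ) ^ d := by
    rw [Real.sqrt_eq_rpow, ← Real.rpow_natCast, ← Real.rpow_mul (by positivity)]
    ring_nf
  have h₀ : ρ₀ ∈ DensityTransport.DensitiesMeanTrace μ₀ τ₀ := ⟨hρ₀, hμ₀, by rw [hP₀, hτ₀]⟩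
  have hmem := DensityTransport.homothety_mem_DensitiesMeanTrace (τ := τ) hκ μ (ν := μ₀)
    (ρ := ρ₀) (by rwa [Real.sq_sqrt (by positivity), div_mul_cancel₀ _ hτ.ne'])
  have hle := DensityTransport.W₂_homothety_sq_le
    (DensityTransport.toMeasure_homothety hκ μ μ₀).symm hmem h₀ hτ pos₀
  rw [hscale]
  refine ⟨le_antisymm ((iInf₂_le _ hmem).trans hle) ?_, hmem, le_antisymm hle ?_⟩
  · exact le_iInf₂ fun ρ hρ => DensityTransport.le_W₂_sq hρ h₀ hτ pos₀
  · exact DensityTransport.le_W₂_sq hmem h₀ hτ pos₀
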